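/- **Setting.** For $m \in \mathbb{N}$, consider real polynomials in the variables $x_{ij}$ ($i,j \in [m]$, $i \neq j$) and $z_j$ ($j \in [m]$), with the usual total degree. For a polynomial $f$ in the $x_{ij}$ alone, let $E_{U_m}[f]$ be its expected value when $a_1,\dots,a_m$ are put in a uniformly random order, with $x_{ij} = 1$ if $a_i < a_j$ and $x_{ij} = 0$ if $a_i > a_j$. Let $\tilde{E}_m$ be the linear functional on all polynomials determined by the following rules: 1. $\tilde{E}_m[p] = E_{U_m}[p]$ for every monomial $p$ in the $x_{ij}$; 2. $\tilde{E}_m\left[\left(\prod_{j \in A} z_j\right) p\right] = 0$ for every nonempty $A \subseteq [m]$ and every monomial $p$ in the $x_{ij}$; 3. $\tilde{E}_m[z_j^2\, p] = \tilde{E}_m\left[\left(\sum_{i \neq j} x_{ij} - 1\right) p\right]$ for every $j \in [m]$ and every monomial $p$ in the $x_{ij}$ and $z_j$. For $1 \leq d_2 \leq n$, let $\Omega_{n,d_2}$ be the probability distribution of a variable $u$ on $\{0,1,\dots,n-d_2\}$ with $\Pr[u=k] = \binom{n-k-1}{d_2-1} / \binom{n}{d_2}$. **Theorem.** Let $d,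 d_2, n$ be natural numbers with $2d \leq d_2 \leq n$. If there is a polynomial $g$ in the variables $x_{ij}, z_j$ ($i,j\in[2n]$) of degree at most $\frac{d}{2}$ such that $\tilde{E}_{2n}[g^2] < 0$, then there is a real univariate polynomial $g_*$ of degree at most $d$ such that $$E_{\Omega_{n,d_2}}\left[(u-1)\, g_*(u)^2\right] < 0.$$ Moreover, if $d_2 \geq 1$, then for every real univariate polynomial $g_*$ this last inequality is equivalent to $$\sum_{k=0}^{n-d_2-1} \frac{\binom{n-k-2}{d_2-1}}{\binom{n-1}{d_2-1}}\, k\, g_*(k+1)^2 < g_*(0)^2 .$$ -/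

import Mathlib

noncomputable section

namespace OrderingPrinciple

open MvPolynomial

/-- Index set of the variables `x i j`, one for each ordered pair `i ≠ j`. -/
abbrev OffDiag (n : ℕ) : Type := {p : Fin n × Fin n // p.1 ≠ p.2}

/-- Index set of all the variables: `Sum.inl (i, j)` is `x i j` (with `i ≠ j`), and
`Sum.inr j` is the auxiliary variable `z j`. -/
abbrev OPVar (n : ℕ) : Type := OffDiag n ⊕ Fin n

/-- The value of `x i j` under the ordering `a (π 0) < a (π 1) < ⋯ < a (π (n - 1))`:
it is `1` if `a i < a j`, and `0` otherwise. -/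
def orderVal {n : ℕ} (π : Equiv.Perm (Fin n)) (e : OffDiag n) : ℝ :=
  if π.symm e.1.1 < π.symm e.1.2 then 1 else 0

/-- The expected value of a polynomial in the variables `x i j` over a uniformly random
ordering. -/
def uniformE (n : ℕ) (f : MvPolynomial (OffDiag n) ℝ) : ℝ :=
  (∑ π : Equiv.Perm (Fin n), eval (orderVal π) f) / (n.factorial : ℝ)

/-- The polynomial `w j = (∑ i ≠ j, x i j) - 1`. -/
def wPoly {n : ℕ} (j : Fin n) : MvPolynomial (OffDiag n) ℝ :=
  (∑ i : {i : Fin n // i ≠ j}, X ⟨(i.1, j), i.2⟩) - 1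

/-- The candidate pseudo-expectation, as a linear functional on all polynomials in the variables
`x i j` and `z j`, given by its values on monomials: each square `z j ^ 2` is replaced by `w j`; if
some `z j` is left over the value is `0`, and otherwise it is the expected value over a uniformly
random ordering. -/
def candidateE (n : ℕ) : MvPolynomial (OPVar n) ℝ →ₗ[ℝ] ℝ :=
  (basisMonomials (OPVar n) ℝ).constr ℝ fun s =>
    open Classical in
    if ∀ j : Fin n, Even (s (Sum.inr j)) then
      uniformE n ((∏ e : OffDiag n, X e ^ s (Sum.inl e)) *
        ∏ j : Fin n, wPoly j ^ (s (Sum.inr j) / 2))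
    else 0

theorem uniformE_sub (n : ℕ) (f g : MvPolynomial (OffDiag n) ℝ) :
    uniformE n (f - g) = uniformE n f - uniformE n g := by
  simp [uniformE, Finset.sum_sub_distrib, sub_div]

theorem uniformE_add (n : ℕ) (f g : MvPolynomial (OffDiag n) ℝ) :
    uniformE n (f + g) = uniformE n f + uniformE n g := by
  simp [uniformE, Finset.sum_add_distrib, add_div]

theorem uniformE_smul (n : ℕ) (c : ℝ) (f : MvPolynomial (OffDiag n) ℝ) :
    uniformE n (c • f) = c * uniformE n f := by
  simp [uniformE, smul_eval, ← Finset.mul_sum, mul_div_assoc]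

theorem uniformE_sum (n : ℕ) {ι : Type*} (t : Finset ι) (f : ι → MvPolynomial (OffDiag n) ℝ) :
    uniformE n (∑ i ∈ t, f i) = ∑ i ∈ t, uniformE n (f i) := by
  classical
  induction t using Finset.induction_on with
  | empty => simp [uniformE]
  | insert a t ha ih => rw [Finset.sum_insert ha, Finset.sum_insert ha, uniformE_add, ih]

open Classical in
theorem candidateE_monomial (n : ℕ) (s : OPVar n →₀ ℕ) :
    candidateE n (monomial s 1) =
      if ∀ j : Fin n, Even (s (Sum.inr j)) then
        uniformE n ((∏ e : OffDiag n, X e ^ s (Sum.inl e)) *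
          ∏ j : Fin n, wPoly j ^ (s (Sum.inr j) / 2))
      else 0 := by
  have h := (basisMonomials (OPVar n) ℝ).constr_basis ℝ (fun s : OPVar n →₀ ℕ =>
    if ∀ j : Fin n, Even (s (Sum.inr j)) then
      uniformE n ((∏ e : OffDiag n, X e ^ s (Sum.inl e)) *
        ∏ j : Fin n, wPoly j ^ (s (Sum.inr j) / 2))
    else 0) s
  simpa [candidateE] using h

/-- First defining rule: on polynomials in the `x i j` alone, the candidate pseudo-expectation is
the expected value over a uniformly random ordering. -/
theorem candidateE_rename (n : ℕ) (f : MvPolynomial (OffDiag n) ℝ) :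
    candidateE n (rename Sum.inl f) = uniformE n f := by
  classical
  rw [f.as_sum, map_sum, map_sum, uniformE_sum]
  refine Finset.sum_congr rfl fun s _ => ?_
  rw [← mul_one (coeff s f), ← smul_eq_mul, ← smul_monomial, map_smul, map_smul, uniformE_smul,
    rename_monomial, candidateE_monomial, if_pos, smul_eq_mul]
  · congr 2
    rw [monomial_eq, C_1, one_mul, Finsupp.prod_fintype _ _ (fun _ => pow_zero _)]
    simp [Finsupp.mapDomain_apply Sum.inl_injective, Finsupp.mapDomain_of_notMem_range]
  · simp [Finsupp.mapDomain_of_notMem_range]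

/-- Second defining rule: it vanishes on `(∏ j ∈ A, z j) * f` for nonempty `A` and `f` a polynomial
in the `x i j` alone. -/
theorem candidateE_prod_z (n : ℕ) (A : Finset (Fin n)) (hA : A.Nonempty)
    (f : MvPolynomial (OffDiag n) ℝ) :
    candidateE n ((∏ j ∈ A, X (Sum.inr j)) * rename Sum.inl f) = 0 := by
  classical
  obtain ⟨j, hj⟩ := hA
  have hprod : (∏ i ∈ A, X (Sum.inr i) : MvPolynomial (OPVar n) ℝ) =
      monomial (∑ i ∈ A, Finsupp.single (Sum.inr i) 1) 1 := by
    rw [monomial_sum_one]; rfl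
  rw [hprod, f.as_sum, map_sum, Finset.mul_sum, map_sum]
  refine Finset.sum_eq_zero fun s _ => ?_
  have hs : monomial s (coeff s f) = coeff s f • (monomial s 1 : MvPolynomial (OffDiag n) ℝ) := by
    rw [smul_monomial, smul_eq_mul, mul_one]
  rw [hs, map_smul, mul_smul_comm, map_smul,
    rename_monomial, monomial_mul, one_mul, candidateE_monomial, if_neg, smul_zero]
  intro h
  have h1 := h j
  simp [Finsupp.mapDomain_of_notMem_range, Finsupp.single_apply, hj] at h1

theorem candidateE_z_sq_monomial (n : ℕ) (j : Fin n) (s : OPVar n →₀ ℕ) :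
    candidateE n (X (Sum.inr j) ^ 2 * monomial s 1) =
      candidateE n (rename Sum.inl (wPoly j) * monomial s 1) := by
  classical
  let σ (v : OPVar n) (m : ℕ) : OPVar n →₀ ℕ := Finsupp.single v m + s
  have hX : ∀ e : OffDiag n, (X (Sum.inl e) * monomial s 1 : MvPolynomial (OPVar n) ℝ) =
      monomial (σ (Sum.inl e) 1) 1 := fun e => by
    rw [X, monomial_mul, one_mul]
  have hZ : (X (Sum.inr j) ^ 2 * monomial s 1 : MvPolynomial (OPVar n) ℝ) =
      monomial (σ (Sum.inr j) 2) 1 := by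
    rw [X_pow_eq_monomial, monomial_mul, one_mul]
  have h1 : ∀ e e' : OffDiag n, σ (Sum.inl e) 1 (Sum.inl e') =
      (if e' = e then 1 else 0) + s (Sum.inl e') := fun e e' => by
    simp [σ, Finsupp.single_apply, eq_comm]
  have h2 : ∀ (e : OffDiag n) (i : Fin n), σ (Sum.inl e) 1 (Sum.inr i) = s (Sum.inr i) :=
    fun e i => by simp [σ]
  have h3 : ∀ e : OffDiag n, σ (Sum.inr j) 2 (Sum.inl e) = s (Sum.inl e) := fun e => by simp [σ]
  have h4 : ∀ i : Fin n, σ (Sum.inr j) 2 (Sum.inr i) =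
      2 * (if i = j then 1 else 0) + s (Sum.inr i) := fun i => by
    simp [σ, Finsupp.single_apply, eq_comm]
  have hprod : ∀ e : OffDiag n, (∏ e' : OffDiag n, X e' ^ σ (Sum.inl e) 1 (Sum.inl e') :
        MvPolynomial (OffDiag n) ℝ) = X e * ∏ e' : OffDiag n, X e' ^ s (Sum.inl e') := fun e => by
    simp only [h1, pow_add, Finset.prod_mul_distrib]
    congr 1
    rw [Finset.prod_eq_single e] <;> simp +contextual
  have hw : (∏ i : Fin n, wPoly i ^ (σ (Sum.inr j) 2 (Sum.inr i) / 2) :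
        MvPolynomial (OffDiag n) ℝ) = wPoly j * ∏ i : Fin n, wPoly i ^ (s (Sum.inr i) / 2) := by
    have h5 : ∀ i : Fin n, σ (Sum.inr j) 2 (Sum.inr i) / 2 =
        (if i = j then 1 else 0) + s (Sum.inr i) / 2 := fun i => by
      rw [h4]; omega
    simp only [h5, pow_add, Finset.prod_mul_distrib]
    congr 1
    rw [Finset.prod_eq_single j] <;> simp +contextual
  have hpar : (∀ i : Fin n, Even (σ (Sum.inr j) 2 (Sum.inr i))) ↔
      ∀ i : Fin n, Even (s (Sum.inr i)) := forall_congr' fun i => by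
    rw [h4, Nat.even_add]; split_ifs <;> simp
  rw [hZ, candidateE_monomial, hw]
  have hR : (rename Sum.inl (wPoly j) * monomial s 1 : MvPolynomial (OPVar n) ℝ) =
      (∑ i : {i : Fin n // i ≠ j}, monomial (σ (Sum.inl ⟨(i.1, j), i.2⟩) 1) 1) -
        monomial s 1 := by
    simp only [wPoly, map_sub, map_sum, map_one, sub_mul, Finset.sum_mul, one_mul, rename_X, hX]
  rw [hR, map_sub, map_sum]
  simp only [candidateE_monomial, hprod, hpar, h2, h3]
  split_ifs with h
  · rw [← uniformE_sum, ← uniformE_sub]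
    congr 1
    simp only [mul_assoc, ← Finset.sum_mul, wPoly]
    ring
  · simp

/-- Third defining rule: `z j ^ 2` may be replaced by `(∑ i ≠ j, x i j) - 1`. -/
theorem candidateE_z_sq (n : ℕ) (j : Fin n) (p : MvPolynomial (OPVar n) ℝ) :
    candidateE n (X (Sum.inr j) ^ 2 * p) = candidateE n (rename Sum.inl (wPoly j) * p) := by
  classical
  rw [p.as_sum, Finset.mul_sum, Finset.mul_sum, map_sum, map_sum]
  refine Finset.sum_congr rfl fun s _ => ?_
  have hs : monomial s (coeff s p) = coeff s p • (monomial s 1 : MvPolynomial (OPVar n) ℝ) := by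
    rw [smul_monomial, smul_eq_mul, mul_one]
  rw [hs, mul_smul_comm, mul_smul_comm, map_smul, map_smul, candidateE_z_sq_monomial]

end OrderingPrinciple

open MeasureTheory in
/-- The distribution on `u ∈ {0, 1, …, n - d}` with
`Pr[u = k] = C(n - k - 1, d - 1) / C(n, d)` (for `1 ≤ d ≤ n`). -/
def OrderingPrinciple.omega (n d : ℕ) : Measure ℕ :=
  ∑ k ∈ Finset.range (n - d + 1),
    ENNReal.ofReal (((n - k - 1).choose (d - 1) : ℝ) / (n.choose d : ℝ)) • Measure.dirac k

theorem OrderingPrinciple.isProbabilityMeasure_omega (n d : ℕ) (hd : 1 ≤ d) (hdn : d ≤ n) :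
    MeasureTheory.IsProbabilityMeasure (OrderingPrinciple.omega n d) := by
  constructor
  have hpos : (0 : ℝ) < (n.choose d : ℝ) := by exact_mod_cast Nat.choose_pos hdn
  have hsum : ∑ k ∈ Finset.range (n - d + 1), (n - k - 1).choose (d - 1) = n.choose d := by
    obtain ⟨e, rfl⟩ : ∃ e, d = e + 1 := ⟨d - 1, by omega⟩
    obtain ⟨m, rfl⟩ : ∃ m, n = m + 1 := ⟨n - 1, by omega⟩
    rw [← Nat.sum_Icc_choose m e]
    refine Finset.sum_bij' (fun k _ => m - k) (fun k _ => m - k) ?_ ?_ ?_ ?_ ?_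
    · intro k hk; simp at hk ⊢; omega
    · intro k hk; simp at hk ⊢; omega
    · intro k hk; simp at hk ⊢; omega
    · intro k hk; simp at hk ⊢; omega
    · intro k hk; congr 1; omega
  simp only [omega, MeasureTheory.Measure.coe_finsetSum, Finset.sum_apply,
    MeasureTheory.Measure.smul_apply, MeasureTheory.measure_univ, smul_eq_mul, mul_one]
  rw [← ENNReal.ofReal_sum_of_nonneg (fun k _ => by positivity), ← Finset.sum_div,
    ← Nat.cast_sum, hsum, div_self hpos.ne', ENNReal.ofReal_one]

end

noncomputable section

namespace OrderingPrinciple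

open MvPolynomial Finset

/-! Positions are counted from 0, so under a fixed order `wPoly j` takes the value (position of `j`)
- 1, and it is negative only for the element in front. Reducing `g` modulo `z j ^ 2 = wPoly j`
splits the value on `g ^ 2` into one term E[∏_{j ∈ A} w_j · g_A²] for each set `A`
(`candidateE_sq`). Some term is negative, and its `A` is nonempty with at most deg g elements.

Write W for ∏_{j ∈ A} w_j and p for g_A. Group the orders by the position k of the first element of
`A`; W ≤ 0 on layer 0 and W ≥ 0 on every other layer. Layer k is compared with layer 0 by a shuffle:
given σ in layer 0, move a random k-set R of positions not taken by `A` to the front. The leading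
element of `A` lands at position k and the others never move forward, so for k ≥ 1 the product W
becomes at least (k - 1)·(-W(σ)) (`wProd_moveFront_ge`). Each x_ij becomes a quadratic in the
indicators of R, so the average of p over R is a polynomial h_σ(k) of degree at most 2 deg p ≤ d
(`exists_polynomial_average`), and by Cauchy–Schwarz the average of p² is at least h_σ(k)².

Summing over σ with weights -W(σ) ≥ 0 gives ∑_σ -W(σ) ∑_k c_k (k - 1) h_σ(k)² < 0, where c_k is the
weight of `omega` up to normalization (`exists_polynomial_sum_neg`, `choose_mul_choose_le`). Hence
some h_σ is the required univariate polynomial. -/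

/-! ### Positions and the polynomials `wPoly` -/

/-- The value of `x i j` when `σ i` is the position of `a i`. -/
def posVal {N : ℕ} (σ : Equiv.Perm (Fin N)) (e : OffDiag N) : ℝ :=
  if σ e.1.1 < σ e.1.2 then 1 else 0

theorem card_filter_perm_lt {N : ℕ} (σ : Equiv.Perm (Fin N)) (x : Fin N) :
    #{y | σ y < σ x} = (σ x : ℕ) := by
  rw [← Fin.card_Iio (σ x)]
  exact card_equiv σ (by simp)

theorem uniformE_eq_sum_posVal (N : ℕ) (f : MvPolynomial (OffDiag N) ℝ) :
    uniformE N f = (∑ σ : Equiv.Perm (Fin N), eval (posVal σ) f) / (N.factorial : ℝ) := by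
  rw [uniformE, ← Equiv.sum_comp (Equiv.inv (Equiv.Perm (Fin N)))]
  rfl

theorem eval_posVal_wPoly {N : ℕ} (σ : Equiv.Perm (Fin N)) (j : Fin N) :
    eval (posVal σ) (wPoly j) = (σ j : ℝ) - 1 := by
  rw [← card_filter_perm_lt σ j, wPoly]
  simp only [map_sub, map_sum, eval_X, map_one, posVal]
  rw [sum_boole]
  congr 2
  refine card_nbij (fun i => i.1) (fun i hi => by simpa using hi) (by simp [Set.InjOn]) ?_
  intro i hi
  have hi' : σ i < σ j := by simpa using hi
  exact ⟨⟨i, by rintro rfl; exact lt_irrefl _ hi'⟩, by simpa using hi', rfl⟩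

theorem totalDegree_wPoly_le {N : ℕ} (j : Fin N) : (wPoly j).totalDegree ≤ 1 := by
  refine (totalDegree_sub _ _).trans (max_le ?_ (by simp))
  exact totalDegree_finsetSum_le fun i _ => (totalDegree_X _).le

/-! ### Reduction to one square -/

/-- The indices `j` for which `z j` occurs to an odd power. -/
def oddPart {N : ℕ} (s : OPVar N →₀ ℕ) : Finset (Fin N) := {j | Odd (s (Sum.inr j))}

/-- The `x`-part of a monomial after all squares `z j ^ 2` are replaced by `wPoly j`. -/
def reducedMonomial {N : ℕ} (s : OPVar N →₀ ℕ) : MvPolynomial (OffDiag N) ℝ :=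
  (∏ e, X e ^ s (Sum.inl e)) * ∏ j, wPoly j ^ (s (Sum.inr j) / 2)

/-- The coefficient of `∏ j ∈ A, z j` in `g` reduced modulo `z j ^ 2 = wPoly j`. -/
def component {N : ℕ} (g : MvPolynomial (OPVar N) ℝ) (A : Finset (Fin N)) :
    MvPolynomial (OffDiag N) ℝ :=
  ∑ s ∈ g.support with oddPart s = A, coeff s g • reducedMonomial s

/-- Where the parities of the two `z`-exponents differ, an odd power of `z j` survives and the value
is 0. Where both are odd, the halved exponents fall one short of half the sum, which yields the
extra factor `wPoly j`. -/
theorem candidateE_monomial_add {N : ℕ} (s t : OPVar N →₀ ℕ) :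
    candidateE N (monomial (s + t) 1) = if oddPart s = oddPart t then
      uniformE N ((∏ j ∈ oddPart s, wPoly j) * (reducedMonomial s * reducedMonomial t)) else 0 := by
  classical
  have hpar : (∀ j : Fin N, Even ((s + t) (Sum.inr j))) ↔ oddPart s = oddPart t := by
    simp only [Finsupp.add_apply, Nat.even_add, oddPart, Finset.ext_iff, mem_filter, mem_univ,
      true_and, ← Nat.not_even_iff_odd, not_iff_not]
  rw [candidateE_monomial, if_congr hpar rfl rfl]
  split_ifs with h
  · congr 1
    have hj : ∀ j : Fin N, (wPoly j : MvPolynomial (OffDiag N) ℝ) ^ ((s + t) (Sum.inr j) / 2) =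
        (if j ∈ oddPart s then wPoly j else 1) *
          (wPoly j ^ (s (Sum.inr j) / 2) * wPoly j ^ (t (Sum.inr j) / 2)) := by
      intro j
      have h1 : Odd (s (Sum.inr j)) ↔ Odd (t (Sum.inr j)) := by
        simpa [oddPart] using Finset.ext_iff.1 h j
      simp only [oddPart, mem_filter, mem_univ, true_and, Finsupp.add_apply]
      rw [Nat.odd_iff, Nat.odd_iff] at h1
      split_ifs with h2
      · rw [Nat.odd_iff] at h2
        rw [← pow_add, ← pow_succ']
        congr 1
        omega
      · rw [Nat.odd_iff] at h2
        rw [← pow_add, one_mul]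
        congr 1
        omega
    rw [prod_congr rfl fun j _ => hj j, prod_mul_distrib, prod_mul_distrib, prod_ite_mem,
      univ_inter]
    simp only [reducedMonomial, Finsupp.add_apply, pow_add, prod_mul_distrib]
    ring
  · rfl

theorem candidateE_sq {N : ℕ} (g : MvPolynomial (OPVar N) ℝ) :
    candidateE N (g ^ 2) = ∑ A : Finset (Fin N),
      uniformE N ((∏ j ∈ A, wPoly j) * component g A ^ 2) := by
  classical
  have hexp : g ^ 2 = ∑ s ∈ g.support, ∑ t ∈ g.support,
      (coeff s g * coeff t g) • (monomial (s + t) 1 : MvPolynomial (OPVar N) ℝ) := by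
    conv_lhs => rw [sq, g.as_sum, sum_mul_sum]
    simp only [monomial_mul, smul_monomial, smul_eq_mul, mul_one]
  have hcomp : ∀ A : Finset (Fin N), uniformE N ((∏ j ∈ A, wPoly j) * component g A ^ 2) =
      ∑ s ∈ g.support, ∑ t ∈ g.support, if oddPart s = A ∧ oddPart t = A then
        (coeff s g * coeff t g) *
          uniformE N ((∏ j ∈ A, wPoly j) * (reducedMonomial s * reducedMonomial t)) else 0 := by
    intro A
    rw [sq, component, sum_mul_sum, mul_sum, uniformE_sum, sum_filter]
    refine sum_congr rfl fun s _ => ?_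
    split_ifs with hs
    · rw [mul_sum, uniformE_sum, sum_filter]
      refine sum_congr rfl fun t _ => ?_
      simp only [hs, true_and, smul_mul_assoc, mul_smul_comm, uniformE_smul]
      split_ifs <;> ring
    · simp [hs]
  rw [hexp, sum_congr rfl fun A _ => hcomp A, map_sum]
  refine Eq.trans ?_ sum_comm
  refine sum_congr rfl fun s _ => ?_
  rw [map_sum]
  refine Eq.trans ?_ sum_comm
  refine sum_congr rfl fun t _ => ?_
  rw [map_smul, candidateE_monomial_add, sum_eq_single (oddPart s)]
  · simp [eq_comm]
  · intro A _ hA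
    rw [if_neg fun h => hA h.1.symm]
  · simp

theorem card_oddPart_le {N : ℕ} (s : OPVar N →₀ ℕ) : #(oddPart s) ≤ s.degree := by
  have h : ∑ j ∈ oddPart s, 1 ≤ ∑ j : Fin N, s (Sum.inr j) :=
    (sum_le_sum fun j hj => (by simpa [oddPart] using hj : Odd (s (Sum.inr j))).pos).trans
      (sum_le_univ_sum_of_nonneg fun _ => Nat.zero_le _)
  rw [Finsupp.degree_eq_sum, Fintype.sum_sum_type]
  simp only [sum_const, smul_eq_mul, mul_one] at h
  omega

theorem totalDegree_reducedMonomial_le {N : ℕ} (s : OPVar N →₀ ℕ) :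
    (reducedMonomial s).totalDegree ≤ s.degree := by
  rw [Finsupp.degree_eq_sum, Fintype.sum_sum_type]
  refine (totalDegree_mul _ _).trans (add_le_add ?_ ?_)
  · exact (totalDegree_finsetProd _ _).trans (sum_le_sum fun e _ => (totalDegree_X_pow _ _).le)
  · refine (totalDegree_finsetProd _ _).trans (sum_le_sum fun j _ => ?_)
    refine (totalDegree_pow _ _).trans ?_
    exact (Nat.mul_le_mul_left _ (totalDegree_wPoly_le j)).trans (by omega)

theorem degree_le_totalDegree {N : ℕ} {g : MvPolynomial (OPVar N) ℝ} {s : OPVar N →₀ ℕ}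
    (hs : s ∈ g.support) : s.degree ≤ g.totalDegree :=
  le_totalDegree hs

theorem totalDegree_component_le {N : ℕ} (g : MvPolynomial (OPVar N) ℝ) (A : Finset (Fin N)) :
    (component g A).totalDegree ≤ g.totalDegree :=
  totalDegree_finsetSum_le fun _ hs => (totalDegree_smul_le _ _).trans
    ((totalDegree_reducedMonomial_le _).trans (degree_le_totalDegree (mem_filter.1 hs).1))

theorem card_le_totalDegree_of_component_ne_zero {N : ℕ} {g : MvPolynomial (OPVar N) ℝ}
    {A : Finset (Fin N)} (h : component g A ≠ 0) : #A ≤ g.totalDegree := by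
  obtain ⟨s, hs, -⟩ := exists_ne_zero_of_sum_ne_zero h
  rw [mem_filter] at hs
  rw [← hs.2]
  exact (card_oddPart_le s).trans (degree_le_totalDegree hs.1)

/-- A negative value on a square is caused by a single product of the `wPoly j`. -/
theorem exists_sum_neg_of_candidateE_sq_neg {N : ℕ} {g : MvPolynomial (OPVar N) ℝ}
    (hg : candidateE N (g ^ 2) < 0) :
    ∃ (A : Finset (Fin N)) (p : MvPolynomial (OffDiag N) ℝ), A.Nonempty ∧
      #A ≤ g.totalDegree ∧ p.totalDegree ≤ g.totalDegree ∧
      ∑ σ : Equiv.Perm (Fin N), (∏ j ∈ A, ((σ j : ℝ) - 1)) * eval (posVal σ) p ^ 2 < 0 := by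
  rw [candidateE_sq] at hg
  obtain ⟨A, -, hA⟩ := exists_lt_of_sum_lt (hg.trans_eq sum_const_zero.symm)
  rw [uniformE_eq_sum_posVal, div_lt_iff₀ (by positivity), zero_mul] at hA
  simp only [map_mul, map_prod, map_pow, eval_posVal_wPoly] at hA
  refine ⟨A, component g A, ?_, ?_, totalDegree_component_le g A, hA⟩
  -- For empty `A` the sum is a sum of squares.
  · rw [nonempty_iff_ne_empty]
    rintro rfl
    refine hA.not_ge (sum_nonneg fun σ _ => ?_)
    rw [prod_empty, one_mul]
    positivity
  · refine card_le_totalDegree_of_component_ne_zero fun h0 => ?_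
    simp [h0] at hA

/-! ### Averages over subsets of fixed size -/

theorem card_powersetCard_filter_superset {α : Type*} [DecidableEq α] {B S : Finset α}
    (hBS : B ⊆ S) {k : ℕ} (hk : #B ≤ k) :
    #{R ∈ powersetCard k S | B ⊆ R} = (#S - #B).choose (k - #B) := by
  rw [← card_sdiff_of_subset hBS, ← card_powersetCard]
  refine card_nbij' (fun R => R \ B) (fun R => R ∪ B) ?_ ?_ ?_ ?_
  · intro R hR
    simp only [mem_coe, mem_filter, mem_powersetCard] at hR ⊢
    exact ⟨sdiff_subset_sdiff hR.1.1 subset_rfl, by rw [card_sdiff_of_subset hR.2, hR.1.2]⟩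
  · intro R hR
    simp only [mem_coe, mem_filter, mem_powersetCard] at hR ⊢
    refine ⟨⟨union_subset (hR.1.trans sdiff_subset) hBS, ?_⟩, subset_union_right⟩
    rw [card_union_of_disjoint (disjoint_of_subset_left hR.1 sdiff_disjoint), hR.2]
    omega
  · intro R hR
    simp only [mem_coe, mem_filter, mem_powersetCard] at hR
    exact sdiff_union_of_subset hR.2
  · intro R hR
    simp only [mem_coe, mem_powersetCard] at hR
    exact union_sdiff_cancel_right (disjoint_of_subset_left hR.1 sdiff_disjoint)

/-- Stated without division, and also for k < |B|, where both sides vanish: thus one falling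
factorial in k gives the probability of B ⊆ R for every k. -/
theorem descFactorial_mul_card_filter_superset {α : Type*} [DecidableEq α] {B S : Finset α}
    (hBS : B ⊆ S) (k : ℕ) :
    (#S).descFactorial #B * #{R ∈ powersetCard k S | B ⊆ R} =
      (#S).choose k * k.descFactorial #B := by
  rcases le_or_gt #B k with h | h
  · rw [card_powersetCard_filter_superset hBS h, Nat.descFactorial_eq_factorial_mul_choose,
      Nat.descFactorial_eq_factorial_mul_choose]
    have := Nat.choose_mul (n := #S) h
    rw [mul_assoc, ← this]
    ring
  · suffices h0 : #{R ∈ powersetCard k S | B ⊆ R} = 0 by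
      rw [h0, Nat.descFactorial_of_lt h, mul_zero, mul_zero]
    refine card_eq_zero.2 (filter_eq_empty_iff.2 fun R hR hB => ?_)
    have := card_le_card hB
    rw [mem_powersetCard] at hR
    omega

/-- The `0/1` vector of a finite set. -/
def indicatorVec {α : Type*} [DecidableEq α] (R : Finset α) (x : α) : ℝ := if x ∈ R then 1 else 0

theorem eval_indicatorVec_monomial {α : Type*} [DecidableEq α] (R : Finset α) (s : α →₀ ℕ)
    (c : ℝ) : eval (indicatorVec R) (monomial s c) = c * if s.support ⊆ R then 1 else 0 := by
  rw [eval_monomial]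
  congr 1
  split_ifs with h
  · exact prod_eq_one fun x hx => by simp [indicatorVec, h hx]
  · obtain ⟨x, hx, hxR⟩ := not_subset.1 h
    refine prod_eq_zero hx ?_
    simpa [indicatorVec, hxR] using hx

theorem card_support_le_totalDegree {α : Type*} {P : MvPolynomial α ℝ} {s : α →₀ ℕ}
    (hs : s ∈ P.support) : #s.support ≤ P.totalDegree := by
  refine le_trans ?_ (le_totalDegree hs)
  rw [Finsupp.sum, card_eq_sum_ones]
  exact sum_le_sum fun x hx => Nat.one_le_iff_ne_zero.2 (Finsupp.mem_support_iff.1 hx)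

/-- The average of a polynomial of degree `D` in the indicators of a random `k`-subset is a
polynomial in `k` of degree at most `D`. -/
theorem exists_polynomial_average {α : Type*} [DecidableEq α] (P : MvPolynomial α ℝ)
    (S : Finset α) : ∃ h : Polynomial ℝ, h.natDegree ≤ P.totalDegree ∧ ∀ k ≤ #S,
      ((#S).choose k : ℝ) * h.eval (k : ℝ) =
        ∑ R ∈ powersetCard k S, eval (indicatorVec R) P := by
  -- On 0/1 points a monomial with support B is the indicator of B ⊆ R. For B ⊆ S its average is the
  -- falling factorial of k of length |B|, divided by that of |S|; otherwise it is 0.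
  refine ⟨∑ s ∈ P.support, Polynomial.C (if s.support ⊆ S then
      coeff s P / ((#S).descFactorial #s.support : ℝ) else 0) *
        descPochhammer ℝ #s.support, ?_, ?_⟩
  · refine Polynomial.natDegree_sum_le_of_forall_le _ _ fun s hs => ?_
    refine (Polynomial.natDegree_C_mul_le _ _).trans ?_
    rw [descPochhammer_natDegree]
    exact card_support_le_totalDegree hs
  · intro k hk
    have hP : ∀ R : Finset α, eval (indicatorVec R) P =
        ∑ s ∈ P.support, coeff s P * if s.support ⊆ R then 1 else 0 := fun R => by
      conv_lhs => rw [P.as_sum, map_sum]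
      exact sum_congr rfl fun s _ => eval_indicatorVec_monomial R s _
    simp only [hP]
    rw [sum_comm, Polynomial.eval_finsetSum, mul_sum]
    refine sum_congr rfl fun s _ => ?_
    rw [← mul_sum, sum_boole, Polynomial.eval_mul, Polynomial.eval_C,
      descPochhammer_eval_eq_descFactorial]
    split_ifs with h
    · have h1 := descFactorial_mul_card_filter_superset h k
      have h2 : ((#S).descFactorial #s.support : ℝ) ≠ 0 := by
        exact_mod_cast (Nat.descFactorial_eq_zero_iff_lt.not.2 (card_le_card h).not_gt)
      have h3 : ((#S).descFactorial #s.support : ℝ) *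
          (#{R ∈ powersetCard k S | s.support ⊆ R} : ℝ) =
          ((#S).choose k : ℝ) * (k.descFactorial #s.support : ℝ) := by exact_mod_cast h1
      field_simp
      linear_combination (-coeff s P) * h3
    · rw [filter_eq_empty_iff.2]
      · simp
      · intro R hR hs
        exact h (hs.trans (mem_powersetCard.1 hR).1)

theorem totalDegree_aeval_le {α β : Type*} (f : α → MvPolynomial β ℝ) {m : ℕ}
    (hf : ∀ a, (f a).totalDegree ≤ m) (p : MvPolynomial α ℝ) :
    (aeval f p).totalDegree ≤ m * p.totalDegree := by
  conv_lhs => rw [p.as_sum, map_sum]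
  refine totalDegree_finsetSum_le fun s hs => ?_
  rw [aeval_monomial]
  refine (totalDegree_mul _ _).trans ?_
  rw [show (algebraMap ℝ (MvPolynomial β ℝ)) (coeff s p) = C (coeff s p) from rfl, totalDegree_C,
    zero_add]
  refine (totalDegree_finsetProd _ _).trans ?_
  refine le_trans (sum_le_sum fun a _ => (totalDegree_pow _ _).trans
    (Nat.mul_le_mul_left _ (hf a))) ?_
  rw [← sum_mul, mul_comm]
  exact Nat.mul_le_mul_left _ (le_totalDegree hs)

/-! ### Shuffles -/

/-- A key that sorts the elements of `R` in front of all others. -/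
def frontKey {N : ℕ} (R : Finset (Fin N)) (x : Fin N) : ℕ := if x ∈ R then x else x + N

theorem frontKey_injective {N : ℕ} (R : Finset (Fin N)) : Function.Injective (frontKey R) := by
  intro x y h
  simp only [frontKey] at h
  ext
  have := x.2
  have := y.2
  split_ifs at h <;> omega

/-- The permutation of the positions that moves the positions in `R` to the front and keeps the
order within `R` and within its complement. -/
def moveFront {N : ℕ} (R : Finset (Fin N)) : Equiv.Perm (Fin N) := (Tuple.sort (frontKey R)).symm

theorem moveFront_lt_iff {N : ℕ} (R : Finset (Fin N)) (x y : Fin N) :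
    moveFront R x < moveFront R y ↔ frontKey R x < frontKey R y := by
  have h : StrictMono (frontKey R ∘ Tuple.sort (frontKey R)) :=
    (Tuple.monotone_sort _).strictMono_of_injective
      ((frontKey_injective R).comp (Equiv.injective _))
  rw [← h.lt_iff_lt]
  simp [moveFront]

theorem card_filter_moveFront_lt {N : ℕ} (R : Finset (Fin N)) (x : Fin N) :
    #{y | frontKey R y < frontKey R x} = (moveFront R x : ℕ) := by
  simp only [← moveFront_lt_iff]
  rw [← Fin.card_Iio (moveFront R x)]
  exact card_equiv (moveFront R) (by simp)

theorem le_moveFront {N : ℕ} {R : Finset (Fin N)} {x : Fin N} (hx : x ∉ R) :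
    (x : ℕ) ≤ moveFront R x := by
  rw [← card_filter_moveFront_lt, ← Fin.card_Iio x]
  refine card_le_card fun y hy => ?_
  simp only [mem_Iio, Fin.lt_def] at hy
  simp only [mem_filter, mem_univ, true_and, frontKey, hx, if_false]
  split_ifs <;> omega

/-- Nothing precedes position 0 before the move, so afterwards exactly the elements of `R` do. This
pins down where the leading element of `A` lands. -/
theorem moveFront_of_val_eq_zero {N : ℕ} {R : Finset (Fin N)} {x : Fin N} (hx : x ∉ R)
    (h0 : (x : ℕ) = 0) : (moveFront R x : ℕ) = #R := by
  rw [← card_filter_moveFront_lt]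
  congr 1
  ext y
  have := y.2
  simp only [mem_filter, mem_univ, true_and, frontKey, hx, if_false]
  split_ifs with h <;> simp only [h, iff_true, iff_false] <;> omega

theorem moveFront_lt_card_iff {N : ℕ} {R : Finset (Fin N)} {x : Fin N} (hx : x ∉ R)
    (h0 : (x : ℕ) = 0) (y : Fin N) : (moveFront R y : ℕ) < #R ↔ y ∈ R := by
  rw [← moveFront_of_val_eq_zero hx h0, ← Fin.lt_def, moveFront_lt_iff]
  have := y.2
  simp only [frontKey, hx, if_false]
  split_ifs with h <;> simp only [h, iff_true, iff_false] <;> omega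

theorem moveFront_empty {N : ℕ} (x : Fin N) : moveFront ∅ x = x := by
  have h : ∀ y : Fin N, frontKey ∅ y < frontKey ∅ x ↔ y < x := fun y => by
    simp [frontKey]
  ext
  rw [← card_filter_moveFront_lt, ← Fin.card_Iio x]
  congr 1
  ext y
  simp [h]

/-! ### The ordering variables after a shuffle -/

/-- The variable `x i j` after moving a set `R` of positions to the front, as a polynomial in the
indicators of `R`. -/
def shuffleVar {N : ℕ} (σ : Equiv.Perm (Fin N)) (e : OffDiag N) : MvPolynomial (Fin N) ℝ :=
  if σ e.1.1 < σ e.1.2 then 1 - (1 - X (σ e.1.1)) * X (σ e.1.2)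
  else X (σ e.1.1) * (1 - X (σ e.1.2))

theorem totalDegree_shuffleVar_le {N : ℕ} (σ : Equiv.Perm (Fin N)) (e : OffDiag N) :
    (shuffleVar σ e).totalDegree ≤ 2 := by
  have hX : ∀ x : Fin N, (X x : MvPolynomial (Fin N) ℝ).totalDegree ≤ 1 :=
    fun x => (totalDegree_X x).le
  have h1 : ∀ x : Fin N, (1 - X x : MvPolynomial (Fin N) ℝ).totalDegree ≤ 1 := fun x =>
    (totalDegree_sub _ _).trans (max_le (by simp) (hX x))
  rw [shuffleVar]
  split_ifs
  · exact (totalDegree_sub _ _).trans (max_le (by simp)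
      ((totalDegree_mul _ _).trans (add_le_add (h1 _) (hX _))))
  · exact (totalDegree_mul _ _).trans (add_le_add (hX _) (h1 _))

/-- An order relation is reversed only when the later position lies in `R` and the earlier one does
not. -/
theorem posVal_moveFront_mul {N : ℕ} (R : Finset (Fin N)) (σ : Equiv.Perm (Fin N))
    (e : OffDiag N) :
    posVal (moveFront R * σ) e = eval (indicatorVec R) (shuffleVar σ e) := by
  have ha := (σ e.1.1).2
  have hb := (σ e.1.2).2
  have hne : (σ e.1.1 : ℕ) ≠ σ e.1.2 := fun h => e.2 (σ.injective (Fin.ext h))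
  simp only [posVal, Equiv.Perm.mul_apply, moveFront_lt_iff]
  simp only [frontKey, shuffleVar, Fin.lt_def]
  by_cases h1 : σ e.1.1 ∈ R <;> by_cases h2 : σ e.1.2 ∈ R <;>
    by_cases h3 : (σ e.1.1 : ℕ) < σ e.1.2 <;>
    simp only [h1, h2, h3, if_true, if_false, map_sub, map_mul, map_one, eval_X, indicatorVec]
  all_goals
    try split_ifs
    all_goals first | omega | norm_num

theorem eval_posVal_moveFront_mul {N : ℕ} (R : Finset (Fin N)) (σ : Equiv.Perm (Fin N))
    (p : MvPolynomial (OffDiag N) ℝ) :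
    eval (posVal (moveFront R * σ)) p =
      eval (indicatorVec R) (aeval (shuffleVar σ) p) := by
  induction p using MvPolynomial.induction_on with
  | C a => simp [algebraMap_eq]
  | add p q hp hq => simp only [map_add, hp, hq]
  | mul_X p e hp => simp only [map_mul, hp, eval_X, aeval_X, posVal_moveFront_mul]

/-! ### Orders by the position of the first element of `A` -/

/-- The orders in which the first element of `A` has position `k`. -/
def firstAt {N : ℕ} (A : Finset (Fin N)) (k : ℕ) : Finset (Equiv.Perm (Fin N)) :=
  {σ | (∃ j ∈ A, (σ j : ℕ) = k) ∧ ∀ j ∈ A, k ≤ σ j}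

theorem mem_firstAt {N : ℕ} {A : Finset (Fin N)} {k : ℕ} {σ : Equiv.Perm (Fin N)} :
    σ ∈ firstAt A k ↔ (∃ j ∈ A, (σ j : ℕ) = k) ∧ ∀ j ∈ A, k ≤ σ j := by
  simp [firstAt]

/-- The positions that are not taken by `A`. -/
def freePos {N : ℕ} (A : Finset (Fin N)) (σ : Equiv.Perm (Fin N)) : Finset (Fin N) :=
  {x | ∀ j ∈ A, σ j ≠ x}

theorem subset_freePos_iff {N : ℕ} {A R : Finset (Fin N)} {σ : Equiv.Perm (Fin N)} :
    R ⊆ freePos A σ ↔ ∀ j ∈ A, σ j ∉ R := by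
  constructor
  · intro h j hj hR
    exact (mem_filter.1 (h hR)).2 j hj rfl
  · intro h x hx
    refine mem_filter.2 ⟨mem_univ _, ?_⟩
    rintro j hj rfl
    exact h j hj hx

theorem card_freePos {N : ℕ} (A : Finset (Fin N)) (σ : Equiv.Perm (Fin N)) :
    #(freePos A σ) = N - #A := by
  have h : freePos A σ = (A.map σ.toEmbedding)ᶜ := by
    ext x
    simp only [freePos, mem_filter, mem_univ, true_and, mem_compl, mem_map, not_exists, not_and,
      Equiv.coe_toEmbedding, ne_eq]
  rw [h, card_compl, card_map, Fintype.card_fin]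

theorem moveFront_mul_mem_firstAt_iff {N : ℕ} {A R : Finset (Fin N)} {σ : Equiv.Perm (Fin N)}
    {x₀ : Fin N} (h0 : (x₀ : ℕ) = 0) (hR : x₀ ∉ R) :
    moveFront R * σ ∈ firstAt A #R ↔ σ ∈ firstAt A 0 ∧ R ⊆ freePos A σ := by
  simp only [mem_firstAt, subset_freePos_iff, Equiv.Perm.mul_apply, Nat.zero_le, implies_true,
    and_true]
  refine and_congr (exists_congr fun j => and_congr_right fun _ => ?_)
    (forall₂_congr fun j _ => ?_)
  · rw [← moveFront_of_val_eq_zero hR h0, ← Fin.ext_iff, (moveFront R).apply_eq_iff_eq,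
      Fin.ext_iff, h0]
  · rw [← not_lt, moveFront_lt_card_iff hR h0]

/-- Double counting. Position 0 is taken by `A`, so R ranges over k-subsets of the other N - 1
positions; for each fixed R, left multiplication by `moveFront R` is a bijection from the admissible
σ onto layer k. -/
theorem sum_firstAt_zero_sum_moveFront {N : ℕ} {A : Finset (Fin N)} (hA : A.Nonempty) (k : ℕ)
    (F : Equiv.Perm (Fin N) → ℝ) :
    ∑ σ ∈ firstAt A 0, ∑ R ∈ powersetCard k (freePos A σ), F (moveFront R * σ) =
      ((N - 1).choose k : ℝ) * ∑ σ ∈ firstAt A k, F σ := by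
  obtain ⟨a, -⟩ := hA
  set x₀ : Fin N := ⟨0, a.pos⟩ with hx₀
  have hcomm : ∑ σ ∈ firstAt A 0, ∑ R ∈ powersetCard k (freePos A σ), F (moveFront R * σ) =
      ∑ R ∈ powersetCard k (univ.erase x₀), ∑ σ ∈ firstAt A 0 with R ⊆ freePos A σ,
        F (moveFront R * σ) := by
    refine sum_comm' fun σ R => ?_
    simp only [mem_powersetCard, mem_filter]
    constructor
    · rintro ⟨hσ, hR, hk⟩
      refine ⟨⟨hσ, hR⟩, fun x hx => mem_erase.2 ⟨?_, mem_univ _⟩, hk⟩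
      rintro rfl
      obtain ⟨⟨j, hj, hj0⟩, -⟩ := mem_firstAt.1 hσ
      refine subset_freePos_iff.1 hR j hj ?_
      rwa [show σ j = x₀ from Fin.ext hj0]
    · rintro ⟨⟨hσ, hR⟩, -, hk⟩
      exact ⟨hσ, hR, hk⟩
  rw [hcomm]
  have hcard : #(powersetCard k (univ.erase x₀)) = (N - 1).choose k := by
    rw [card_powersetCard, card_erase_of_mem (mem_univ _), card_univ, Fintype.card_fin]
  rw [← hcard, ← nsmul_eq_mul]
  refine sum_eq_card_nsmul fun R hR => ?_
  obtain ⟨hRx, rfl⟩ := mem_powersetCard.1 hR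
  have hxR : x₀ ∉ R := fun h => (mem_erase.1 (hRx h)).1 rfl
  refine sum_equiv (Equiv.mulLeft (moveFront R)) (fun σ => ?_) fun σ _ => rfl
  rw [Equiv.coe_mulLeft, moveFront_mul_mem_firstAt_iff rfl hxR, mem_filter]

/-- The product of the values of the `wPoly j` for `j ∈ A`. -/
def wProd {N : ℕ} (A : Finset (Fin N)) (σ : Equiv.Perm (Fin N)) : ℝ := ∏ j ∈ A, ((σ j : ℝ) - 1)

theorem wProd_nonneg {N : ℕ} {A : Finset (Fin N)} {σ : Equiv.Perm (Fin N)}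
    (h : ∀ j ∈ A, 1 ≤ (σ j : ℕ)) : 0 ≤ wProd A σ :=
  prod_nonneg fun j hj => sub_nonneg.2 (by exact_mod_cast h j hj)

theorem wProd_nonneg_of_notMem_firstAt {N : ℕ} {A : Finset (Fin N)} {σ : Equiv.Perm (Fin N)}
    (h : σ ∉ firstAt A 0) : 0 ≤ wProd A σ := by
  refine wProd_nonneg fun j hj => ?_
  by_contra hlt
  exact h (mem_firstAt.2 ⟨⟨j, hj, by omega⟩, fun _ _ => Nat.zero_le _⟩)

theorem one_le_of_mem_erase {N : ℕ} {A : Finset (Fin N)} {σ : Equiv.Perm (Fin N)} {a j : Fin N}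
    (ha : (σ a : ℕ) = 0) (hj : j ∈ A.erase a) : 1 ≤ (σ j : ℕ) := by
  rw [Nat.one_le_iff_ne_zero]
  intro h
  exact (mem_erase.1 hj).1 (σ.injective (Fin.ext (h.trans ha.symm)))

theorem wProd_nonpos_of_mem_firstAt {N : ℕ} {A : Finset (Fin N)} {σ : Equiv.Perm (Fin N)}
    (h : σ ∈ firstAt A 0) : wProd A σ ≤ 0 := by
  obtain ⟨⟨a, ha, ha0⟩, -⟩ := mem_firstAt.1 h
  rw [wProd, ← mul_prod_erase _ _ ha, ha0]
  have : 0 ≤ wProd (A.erase a) σ := wProd_nonneg fun j hj => one_le_of_mem_erase ha0 hj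
  rw [wProd] at this
  push_cast
  linarith

/-- The factor -1 of the leading element turns into #R - 1. All other factors are nonnegative and do
not decrease, since positions outside `R` never move forward. -/
theorem wProd_moveFront_ge {N : ℕ} {A R : Finset (Fin N)} {σ : Equiv.Perm (Fin N)}
    (h : σ ∈ firstAt A 0) (hR : R ⊆ freePos A σ) (hR1 : 1 ≤ #R) :
    -wProd A σ * ((#R : ℝ) - 1) ≤ wProd A (moveFront R * σ) := by
  obtain ⟨⟨a, ha, ha0⟩, -⟩ := mem_firstAt.1 h
  have hRA := subset_freePos_iff.1 hR
  have hle : wProd (A.erase a) σ ≤ wProd (A.erase a) (moveFront R * σ) := by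
    refine prod_le_prod (fun j hj => sub_nonneg.2 ?_) fun j hj => ?_
    · exact_mod_cast one_le_of_mem_erase ha0 hj
    · have := le_moveFront (hRA j (mem_of_mem_erase hj))
      have : (σ j : ℝ) ≤ (moveFront R (σ j) : ℕ) := by exact_mod_cast this
      rw [Equiv.Perm.mul_apply]
      linarith
  have hk : (0 : ℝ) ≤ (#R : ℝ) - 1 := sub_nonneg.2 (by exact_mod_cast hR1)
  rw [wProd] at hle ⊢
  rw [wProd] at hle ⊢
  rw [← mul_prod_erase A _ ha, ← mul_prod_erase A _ ha, ha0, Equiv.Perm.mul_apply,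
    moveFront_of_val_eq_zero (hRA a ha) ha0]
  rw [Nat.cast_zero]
  linarith [mul_le_mul_of_nonneg_left hle hk]

/-- The layers are disjoint, and layer 0 holds every negative term, so the orders left out
contribute nonnegatively. -/
theorem sum_range_sum_firstAt_le {N : ℕ} (A : Finset (Fin N)) (K : ℕ)
    (f : Equiv.Perm (Fin N) → ℝ) :
    ∑ k ∈ range (K + 1), ∑ σ ∈ firstAt A k, wProd A σ * f σ ^ 2 ≤
      ∑ σ, wProd A σ * f σ ^ 2 := by
  rw [← sum_biUnion]
  · refine sum_le_sum_of_subset_of_nonneg (subset_univ _) fun σ _ hσ => ?_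
    refine mul_nonneg (wProd_nonneg_of_notMem_firstAt fun h => hσ ?_) (sq_nonneg _)
    exact mem_biUnion.2 ⟨0, by simp, h⟩
  · intro k _ l _ hkl
    refine disjoint_left.2 fun σ hk hl => hkl ?_
    obtain ⟨⟨a, ha, rfl⟩, h1⟩ := mem_firstAt.1 hk
    obtain ⟨⟨b, hb, rfl⟩, h2⟩ := mem_firstAt.1 hl
    exact le_antisymm (h1 b hb) (h2 a ha)

/-! ### The univariate polynomial -/

/-- The shuffle bounds layer k from below with the factor C(N - |A|, k) / C(N - 1, k). The
hypothesis `hcK` says that c k / c 0 does not exceed this factor. -/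
theorem exists_polynomial_sum_neg {N : ℕ} {A : Finset (Fin N)} (hA : A.Nonempty)
    (p : MvPolynomial (OffDiag N) ℝ)
    (hneg : ∑ σ : Equiv.Perm (Fin N), wProd A σ * eval (posVal σ) p ^ 2 < 0)
    {K : ℕ} (hK : K ≤ N - #A) {c : ℕ → ℝ} (hc : ∀ k, 0 ≤ c k) (hc0 : 0 < c 0)
    (hcK : ∀ k ≤ K, c k * ((N - 1).choose k : ℝ) ≤ c 0 * ((N - #A).choose k : ℝ)) :
    ∃ h : Polynomial ℝ, h.natDegree ≤ 2 * p.totalDegree ∧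
      ∑ k ∈ range (K + 1), c k * (((k : ℝ) - 1) * h.eval (k : ℝ) ^ 2) < 0 := by
  have havg := fun σ : Equiv.Perm (Fin N) =>
    exists_polynomial_average (aeval (shuffleVar σ) p) (freePos A σ)
  simp only [card_freePos, ← eval_posVal_moveFront_mul] at havg
  choose h hdeg heval using havg
  by_contra! hcon
  have hnn : ∀ σ, 0 ≤ ∑ k ∈ range (K + 1), c k * (((k : ℝ) - 1) * (h σ).eval (k : ℝ) ^ 2) :=
    fun σ => hcon (h σ) ((hdeg σ).trans
      (totalDegree_aeval_le _ (totalDegree_shuffleVar_le σ) p))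
  have hterm : ∀ k ∈ range (K + 1),
      ∑ σ ∈ firstAt A 0, -wProd A σ * (c k * (((k : ℝ) - 1) * (h σ).eval (k : ℝ) ^ 2)) ≤
        c 0 * ∑ σ ∈ firstAt A k, wProd A σ * eval (posVal σ) p ^ 2 := by
    intro k hk
    have hkK : k ≤ K := Nat.lt_succ_iff.1 (mem_range.1 hk)
    rcases Nat.eq_zero_or_pos k with rfl | hpos
    -- For k = 0 only R = ∅ occurs, so h_σ(0) is the value of p at σ and equality holds. This
    -- matters because the coefficient k - 1 = -1 would reverse a Cauchy–Schwarz estimate.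
    · rw [mul_sum]
      refine (sum_congr rfl fun σ _ => ?_).le
      have h0 := heval σ 0 (Nat.zero_le _)
      rw [powersetCard_zero, sum_singleton, Nat.choose_zero_right,
        show moveFront ∅ * σ = σ from Equiv.ext fun x => moveFront_empty _] at h0
      rw [← h0]
      push_cast
      ring
    · have hC : (0 : ℝ) < ((N - #A).choose k : ℝ) := by
        exact_mod_cast Nat.choose_pos (hkK.trans hK)
      have hpt : ∀ σ ∈ firstAt A 0,
          ((N - #A).choose k : ℝ) * (-wProd A σ * (((k : ℝ) - 1) * (h σ).eval (k : ℝ) ^ 2)) ≤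
            ∑ R ∈ powersetCard k (freePos A σ),
              wProd A (moveFront R * σ) * eval (posVal (moveFront R * σ)) p ^ 2 := by
        intro σ hσ
        -- Cauchy–Schwarz over R: the squared average h_σ(k)² is at most the average of p².
        have hsq := sq_sum_le_card_mul_sum_sq (s := powersetCard k (freePos A σ))
          (f := fun R => eval (posVal (moveFront R * σ)) p)
        rw [← heval σ k (hkK.trans hK), card_powersetCard, card_freePos, mul_pow, sq
          ((N - #A).choose k : ℝ), mul_assoc] at hsq
        have hsq' := le_of_mul_le_mul_left hsq hC
        have hk1 : (0 : ℝ) ≤ (k : ℝ) - 1 := sub_nonneg.2 (by exact_mod_cast hpos)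
        have hW : 0 ≤ -wProd A σ * ((k : ℝ) - 1) :=
          mul_nonneg (neg_nonneg.2 (wProd_nonpos_of_mem_firstAt hσ)) hk1
        calc ((N - #A).choose k : ℝ) *
              (-wProd A σ * (((k : ℝ) - 1) * (h σ).eval (k : ℝ) ^ 2))
            = -wProd A σ * ((k : ℝ) - 1) *
              (((N - #A).choose k : ℝ) * (h σ).eval (k : ℝ) ^ 2) := by ring
          _ ≤ -wProd A σ * ((k : ℝ) - 1) * ∑ R ∈ powersetCard k (freePos A σ),
              eval (posVal (moveFront R * σ)) p ^ 2 := mul_le_mul_of_nonneg_left hsq' hW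
          _ ≤ _ := by
            rw [mul_sum]
            refine sum_le_sum fun R hR => mul_le_mul_of_nonneg_right ?_ (sq_nonneg _)
            obtain ⟨hRA, rfl⟩ := mem_powersetCard.1 hR
            exact wProd_moveFront_ge hσ hRA hpos
      have hsum := sum_le_sum hpt
      rw [sum_firstAt_zero_sum_moveFront hA k
        (fun σ => wProd A σ * eval (posVal σ) p ^ 2), ← mul_sum] at hsum
      have hG : 0 ≤ ∑ σ ∈ firstAt A k, wProd A σ * eval (posVal σ) p ^ 2 :=
        sum_nonneg fun σ hσ => mul_nonneg
          (wProd_nonneg fun j hj => hpos.trans_le ((mem_firstAt.1 hσ).2 j hj)) (sq_nonneg _)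
      refine le_of_mul_le_mul_left ?_ hC
      have h1 := mul_le_mul_of_nonneg_left hsum (hc k)
      -- The weights can be exchanged because the sum over layer k ≥ 1 is nonnegative.
      have h2 := mul_le_mul_of_nonneg_right (hcK k hkK) hG
      calc _ = c k * (((N - #A).choose k : ℝ) * ∑ σ ∈ firstAt A 0,
              (-wProd A σ * (((k : ℝ) - 1) * (h σ).eval (k : ℝ) ^ 2))) := by
            simp only [mul_sum]
            exact sum_congr rfl fun σ _ => by ring
        _ ≤ _ := h1
        _ = _ := (mul_assoc _ _ _).symm
        _ ≤ _ := h2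
        _ = _ := by ring
  have hsum := sum_le_sum hterm
  rw [sum_comm, ← mul_sum] at hsum
  have hle := mul_le_mul_of_nonneg_left (sum_range_sum_firstAt_le A K
    fun σ => eval (posVal σ) p) hc0.le
  have hlow : 0 ≤ ∑ σ ∈ firstAt A 0, ∑ k ∈ range (K + 1),
      -wProd A σ * (c k * (((k : ℝ) - 1) * (h σ).eval (k : ℝ) ^ 2)) :=
    sum_nonneg fun σ hσ => by
      rw [← mul_sum]
      exact mul_nonneg (neg_nonneg.2 (wProd_nonpos_of_mem_firstAt hσ)) (hnn σ)
  have := mul_neg_of_pos_of_neg hc0 hneg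
  linarith

/-! ### The distribution `omega` -/

/-- Both sides agree at k = 0, so it suffices to compare consecutive ratios: (n - k - d)/(n - k - 1)
≤ (N - k - s)/(N - k - 1). This holds because 1 - (d - 1)/(n - k - 1) can only grow when d is
lowered to s and n raised to N. -/
theorem choose_mul_choose_le {n d N s : ℕ} (hs : 1 ≤ s) (hsd : s ≤ d) (hdn : d ≤ n)
    (hnN : n ≤ N) {k : ℕ} (hk : k ≤ n - d) :
    (n - k - 1).choose (d - 1) * (N - 1).choose k ≤
      (n - 1).choose (d - 1) * (N - s).choose k := by
  induction k with
  | zero => simp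
  | succ k ih =>
    have ih := ih (by omega)
    obtain ⟨m, hm⟩ : ∃ m, n = d + k + 1 + m := ⟨n - d - k - 1, by omega⟩
    obtain ⟨r, hr⟩ : ∃ r, N = n + r := ⟨N - n, by omega⟩
    obtain ⟨e, rfl⟩ : ∃ e, d = e + 1 := ⟨d - 1, by omega⟩
    obtain ⟨t, rfl⟩ : ∃ t, s = t + 1 := ⟨s - 1, by omega⟩
    have h1 : (e + 1 + m) * (n - (k + 1) - 1).choose e =
        (m + 1) * (n - k - 1).choose e := by
      rw [show n - k - 1 = (n - (k + 1) - 1) + 1 by omega]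
      have h := Nat.choose_mul_succ_eq (n - (k + 1) - 1) e
      rw [show n - (k + 1) - 1 + 1 = e + 1 + m by omega] at h ⊢
      rw [show e + 1 + m - e = m + 1 by omega] at h
      rw [mul_comm, h, mul_comm]
    have h2 := Nat.choose_succ_right_eq (N - 1) k
    have h3 := Nat.choose_succ_right_eq (N - (t + 1)) k
    simp only [Nat.add_sub_cancel] at ih ⊢
    have key : (m + 1) * (N - 1 - k) ≤ (e + 1 + m) * (N - (t + 1) - k) := by
      obtain ⟨q, rfl⟩ : ∃ q, e = t + q := ⟨e - t, by omega⟩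
      rw [show N - 1 - k = t + q + 1 + m + r by omega,
        show N - (t + 1) - k = q + 1 + m + r by omega]
      nlinarith [Nat.zero_le (t * q), Nat.zero_le (t * r), Nat.zero_le (q * r)]
    -- This factor clears the denominators of the three ratio identities `h1`, `h2`, `h3`.
    refine Nat.le_of_mul_le_mul_left (c := (e + 1 + m) * (k + 1)) ?_
      (by positivity)
    calc (e + 1 + m) * (k + 1) *
          ((n - (k + 1) - 1).choose e * (N - 1).choose (k + 1))
        = ((e + 1 + m) * (n - (k + 1) - 1).choose e) *
          ((N - 1).choose (k + 1) * (k + 1)) := by ring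
      _ = ((n - k - 1).choose e * (N - 1).choose k) * ((m + 1) * (N - 1 - k)) := by
        rw [h1, h2]; ring
      _ ≤ ((n - 1).choose e * (N - (t + 1)).choose k) *
          ((e + 1 + m) * (N - (t + 1) - k)) := Nat.mul_le_mul ih key
      _ = (e + 1 + m) * (n - 1).choose e *
          ((N - (t + 1)).choose (k + 1) * (k + 1)) := by rw [h3]; ring
      _ = _ := by ring

theorem integral_omega (n d : ℕ) (f : ℕ → ℝ) :
    ∫ u, f u ∂(omega n d) =
      (∑ k ∈ range (n - d + 1), ((n - k - 1).choose (d - 1) : ℝ) * f k) / (n.choose d : ℝ) := by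
  rw [omega, MeasureTheory.integral_finsetSum_measure, sum_div]
  · refine sum_congr rfl fun k _ => ?_
    rw [MeasureTheory.integral_smul_measure, MeasureTheory.integral_dirac,
      ENNReal.toReal_ofReal (by positivity), smul_eq_mul]
    ring
  · intro k _
    exact (MeasureTheory.integrable_dirac (by simp)).smul_measure ENNReal.ofReal_ne_top

end OrderingPrinciple

end

theorem mainTheorem6 (d d₂ n : ℕ) (hd : 2 * d ≤ d₂) (hn : d₂ ≤ n) :
    ((∃ g : MvPolynomial (OrderingPrinciple.OPVar (2 * n)) ℝ,
        2 * g.totalDegree ≤ d ∧ OrderingPrinciple.candidateE (2 * n) (g ^ 2) < 0) →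
      ∃ gs : Polynomial ℝ, gs.natDegree ≤ d ∧
        ∫ u, ((u : ℝ) - 1) * gs.eval (u : ℝ) ^ 2 ∂(OrderingPrinciple.omega n d₂) < 0) ∧
    (0 < d₂ → ∀ gs : Polynomial ℝ,
      (∫ u, ((u : ℝ) - 1) * gs.eval (u : ℝ) ^ 2 ∂(OrderingPrinciple.omega n d₂) < 0 ↔
        ∑ k ∈ Finset.range (n - d₂),
          ((n - k - 2).choose (d₂ - 1) : ℝ) / ((n - 1).choose (d₂ - 1) : ℝ) * (k : ℝ) *
            gs.eval ((k : ℝ) + 1) ^ 2 < gs.eval 0 ^ 2)) := by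
  have hpos : (0 : ℝ) < (n.choose d₂ : ℝ) := by exact_mod_cast Nat.choose_pos hn
  constructor
  · rintro ⟨g, hg, hneg⟩
    obtain ⟨A, p, hA, hAg, hpg, hsum⟩ :=
      OrderingPrinciple.exists_sum_neg_of_candidateE_sq_neg hneg
    -- A nonempty `A` forces deg g ≥ 1, hence d ≥ 2 and d₂ ≥ 4, so the truncated subtraction in d₂ -
    -- 1 is harmless.
    have hA1 : 1 ≤ A.card := hA.card_pos
    obtain ⟨h, hh, hh_neg⟩ := OrderingPrinciple.exists_polynomial_sum_neg hA p hsum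
      (K := n - d₂) (by omega) (c := fun k => ((n - k - 1).choose (d₂ - 1) : ℝ))
      (fun k => by positivity)
      (by exact_mod_cast Nat.choose_pos (show d₂ - 1 ≤ n - 0 - 1 by omega))
      (fun k hk => by
        exact_mod_cast OrderingPrinciple.choose_mul_choose_le hA1 (by omega) hn (by omega) hk)
    refine ⟨h, by omega, ?_⟩
    rw [OrderingPrinciple.integral_omega]
    exact div_neg_of_neg_of_pos hh_neg hpos
  · intro hd₂ gs
    have hpos' : (0 : ℝ) < ((n - 1).choose (d₂ - 1) : ℝ) := by
      exact_mod_cast Nat.choose_pos (show d₂ - 1 ≤ n - 1 by omega)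
    have hsum : ∑ k ∈ Finset.range (n - d₂),
        ((n - k - 2).choose (d₂ - 1) : ℝ) / ((n - 1).choose (d₂ - 1) : ℝ) * (k : ℝ) *
          gs.eval ((k : ℝ) + 1) ^ 2 =
        (∑ k ∈ Finset.range (n - d₂), ((n - (k + 1) - 1).choose (d₂ - 1) : ℝ) *
          ((((k + 1 : ℕ) : ℝ) - 1) * gs.eval ((k + 1 : ℕ) : ℝ) ^ 2)) /
            ((n - 1).choose (d₂ - 1) : ℝ) := by
      rw [Finset.sum_div]
      refine Finset.sum_congr rfl fun k _ => ?_
      rw [show n - (k + 1) - 1 = n - k - 2 by omega]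
      push_cast
      ring
    -- The positive normalization C(n, d₂) drops out. The split-off term k = 0 is -C(n - 1, d₂ - 1)
    -- · gs(0)², which becomes the right-hand side.
    rw [OrderingPrinciple.integral_omega n d₂ fun u => ((u : ℝ) - 1) * gs.eval (u : ℝ) ^ 2,
      div_lt_iff₀ hpos, zero_mul, Finset.sum_range_succ', hsum, div_lt_iff₀ hpos',
      ← sub_neg (b := _ * ((n - 1).choose (d₂ - 1) : ℝ)), Nat.cast_zero, Nat.sub_zero]
    refine iff_of_eq (congrArg (· < (0 : ℝ)) ?_)
    ring
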